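/- Let $n \ge 3$ be an integer, let $a, b$ be positive integers, and suppose that the positive real number $\xi = \sqrt[n]{a/b}$ is algebraic of degree exactly $n$ over $\mathbb{Q}$. Then for every real number $\varepsilon > 0$ and every integer $m \ge 1$, the inequality $$\left|\xi - \frac{p}{q}\right| \le q^{-\left(\frac{n}{m} + m - 1\right) - \varepsilon}$$ has only finitely many rational solutions $p/q$ with $p, q \in \mathbb{Z}$ and $q > 0$; here fractions are counted as pairs $(p,q)$, not necessarily in lowest terms. -/

import Mathlib

open Polynomial

attribute [local instance] Matrix.seminormedAddCommGroup

/-! This is the Thue–Siegel method. Siegel's lemma gives a nonzero integer polynomial P(X, Y) =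
∑_{j<m} F_j(X) Y^j of controlled size and X-degree at most R, with P(X, ξ) vanishing at ξ to high
order T. Near (ξ, ξ) its low X-derivatives are small, while a nonzero one at rationals x, y with
denominators q₁, q₂ is at least q₁^{-R} q₂^{-(m-1)}. So two approximations cannot both be too good
(`exists_thue_siegel_constant`).

The crux is a nonvanishing derivative of low order (`order_add_mul_order_le`). The Wronskian of a
basis of the span of the F_j is a nonzero rational polynomial of degree at most mR. Up to bounded
losses it is divisible by minpoly(ξ)^T and by (X - x)^k, so nT + k ≤ mR roughly; Siegel's lemma
allows nT close to mR.

With R ≈ Nns, T = Nms and q₂ ≈ q₁^{Nms}, the bounds conflict for large N once θm > n + m(m - 1),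
that is θ > n/m + m - 1. -/

/-! ### Wronskians -/

/-- The Wronskian matrix of a finite family of polynomials. -/
noncomputable def wronskianMatrix {K : Type*} [CommRing K] {h : ℕ} (G : Fin h → K[X]) :
    Matrix (Fin h) (Fin h) K[X] :=
  Matrix.of fun i l => derivative^[(i : ℕ)] (G l)

theorem wronskianMatrix_map {K L : Type*} [CommRing K] [CommRing L] (φ : K →+* L) {h : ℕ}
    (G : Fin h → K[X]) :
    (wronskianMatrix fun l => (G l).map φ).det = (wronskianMatrix G).det.map φ := by
  rw [← coe_mapRingHom, RingHom.map_det]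
  congr 1
  ext1 i l
  simp [wronskianMatrix, iterate_derivative_map]

theorem natDegree_det_wronskianMatrix_le {K : Type*} [CommRing K] {h r : ℕ} (G : Fin h → K[X])
    (hG : ∀ l, (G l).natDegree ≤ r) : (wronskianMatrix G).det.natDegree ≤ h * r := by
  rw [Matrix.det_apply]
  refine natDegree_sum_le_of_forall_le _ _ fun σ _ => ?_
  refine (natDegree_smul_le _ _).trans ((natDegree_prod_le _ _).trans ?_)
  refine (Finset.sum_le_card_nsmul _ _ r fun i _ => ?_).trans (by simp)
  exact (natDegree_iterate_derivative _ _).trans ((Nat.sub_le _ _).trans (hG _))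

theorem iterate_derivative_C_sum {K : Type*} [CommRing K] {ι : Type*} (s : Finset ι) (v : ι → K)
    (G : ι → K[X]) (i : ℕ) :
    derivative^[i] (∑ l ∈ s, C (v l) * G l) = ∑ l ∈ s, C (v l) * derivative^[i] (G l) := by
  rw [iterate_derivative_sum]
  simp [iterate_derivative_C_mul]

/-- If a nonzero combination of the `G l` vanishes at `a` to high order, so does the Wronskian. -/
theorem pow_dvd_det_wronskianMatrix {K : Type*} [Field K] {h k : ℕ} (G : Fin h → K[X])
    (v : Fin h → K) (hv : v ≠ 0) (a : K)
    (hdvd : (X - C a) ^ (k + h) ∣ ∑ l, C (v l) * G l) :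
    (X - C a) ^ k ∣ (wronskianMatrix G).det := by
  obtain ⟨l, hl⟩ := Function.ne_iff.1 hv
  have hmul : (wronskianMatrix G).mulVec (fun l => C (v l)) =
      fun i : Fin h => derivative^[(i : ℕ)] (∑ l, C (v l) * G l) := by
    ext1 i
    rw [iterate_derivative_C_sum]
    simp [Matrix.mulVec, dotProduct, wronskianMatrix, mul_comm]
  -- Cramer's rule: the determinant is, up to the unit `v l`, a combination of derivatives of order
  -- less than `h` of the vanishing sum.
  have key : (wronskianMatrix G).det * C (v l) =
      ∑ i, (wronskianMatrix G).adjugate l i * derivative^[(i : ℕ)] (∑ l, C (v l) * G l) := by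
    have := congrFun (congrArg ((wronskianMatrix G).adjugate.mulVec) hmul) l
    rw [Matrix.mulVec_mulVec, Matrix.adjugate_mul, Matrix.smul_mulVec, Matrix.one_mulVec] at this
    simpa [Matrix.mulVec, dotProduct] using this
  have hu : IsUnit (C (v l)) := isUnit_C.2 (isUnit_iff_ne_zero.2 hl)
  rw [← hu.dvd_mul_right, key]
  refine Finset.dvd_sum fun i _ => Dvd.dvd.mul_left ?_ _
  exact (pow_dvd_pow _ (by omega)).trans (pow_sub_dvd_iterate_derivative_of_pow_dvd (i : ℕ) hdvd)

/-- A solution of a linear differential equation of order `k` that vanishes to order `k` at a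
regular point is zero. -/
theorem eq_zero_of_differential_equation {K : Type*} [Field K] [CharZero K] {k : ℕ}
    (c : ℕ → K[X]) (x : K) (hc : (c k).eval x ≠ 0) (f : K[X])
    (hf : ∑ i ∈ Finset.range (k + 1), c i * derivative^[i] f = 0)
    (h0 : ∀ i < k, (derivative^[i] f).eval x = 0) : f = 0 := by
  by_contra hne
  set d := f.rootMultiplicity x with hd
  have hkd : k ≤ d := by
    rcases k with _ | k
    · exact Nat.zero_le _
    · exact lt_rootMultiplicity_of_isRoot_iterate_derivative hne
        fun i hi => h0 i (Nat.lt_succ_of_le hi)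
  have hdvd : (X - C x) ^ d ∣ f := pow_rootMultiplicity_dvd f x
  -- The lower-order terms vanish to order at least d - k + 1, whereas the k-th derivative has order
  -- exactly d - k and `c k` is a unit at x.
  have h1 : (X - C x) ^ (d - k + 1) ∣ c k * derivative^[k] f := by
    rw [Finset.sum_range_succ] at hf
    rw [← neg_eq_of_add_eq_zero_right hf, dvd_neg]
    refine Finset.dvd_sum fun i hi => Dvd.dvd.mul_left ?_ _
    have := Finset.mem_range.1 hi
    exact (pow_dvd_pow _ (by omega)).trans (pow_sub_dvd_iterate_derivative_of_pow_dvd i hdvd)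
  have hcop : IsCoprime ((X - C x) ^ (d - k + 1)) (c k) := by
    refine IsCoprime.pow_left ?_
    rw [(irreducible_X_sub_C x).coprime_iff_not_dvd, dvd_iff_isRoot]
    exact hc
  have h2 := pow_sub_dvd_iterate_derivative_of_pow_dvd (d - k) (hcop.dvd_of_dvd_mul_left h1)
  rw [Nat.add_sub_cancel_left, pow_one, ← Function.iterate_add_apply, Nat.sub_add_cancel hkd,
    dvd_iff_isRoot, IsRoot, eval_iterate_derivative_rootMultiplicity, nsmul_eq_mul] at h2
  exact mul_ne_zero (Nat.cast_ne_zero.2 (Nat.factorial_ne_zero _))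
    (eval_divByMonic_pow_rootMultiplicity_ne_zero x hne) h2

/-- A left null vector of the matrix is a linear differential equation of order k < h satisfied by
every `G l`. At a regular point the k initial conditions leave a nontrivial combination of the h
functions, and uniqueness forces it to be zero. -/
theorem det_wronskianMatrix_ne_zero {K : Type*} [Field K] [CharZero K] {h : ℕ} (G : Fin h → K[X])
    (hG : LinearIndependent K G) : (wronskianMatrix G).det ≠ 0 := by
  intro hdet
  obtain ⟨c, hc, hcG⟩ := Matrix.exists_vecMul_eq_zero_iff.2 hdet
  classical
  obtain ⟨i₀, hi₀⟩ := Function.ne_iff.1 hc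
  have hne : (Finset.univ.filter fun i => c i ≠ 0).Nonempty := ⟨i₀, by simpa using hi₀⟩
  set k := (Finset.univ.filter fun i => c i ≠ 0).max' hne with hk
  have hck : c k ≠ 0 := by
    simpa using Finset.max'_mem _ hne
  have hgt : ∀ i, k < i → c i = 0 := by
    intro i hi
    by_contra h
    exact absurd (Finset.le_max' (Finset.univ.filter fun i => c i ≠ 0) i (by simpa using h))
      (not_le.2 hi)
  obtain ⟨x, hx⟩ : ∃ x, (c k).eval x ≠ 0 := by
    by_contra! h
    exact hck (Polynomial.funext (by simpa using h))
  set c' : ℕ → K[X] := fun i => if hi : i < h then c ⟨i, hi⟩ else 0 with hc'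
  have hsum : ∀ f : K[X], ∑ i, c i * derivative^[(i : ℕ)] f =
      ∑ i ∈ Finset.range (k + 1), c' i * derivative^[i] f := by
    intro f
    have h1 : ∑ i, c i * derivative^[(i : ℕ)] f =
        ∑ i : Fin h, c' i * derivative^[(i : ℕ)] f :=
      Finset.sum_congr rfl fun i _ => by simp [hc']
    rw [h1, Fin.sum_univ_eq_sum_range (fun i => c' i * derivative^[i] f) h]
    refine (Finset.sum_subset (Finset.range_mono k.2) fun i hi hi' => ?_).symm
    have hih := Finset.mem_range.1 hi
    rw [hc']
    simp only [hih, dif_pos]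
    rw [hgt ⟨i, hih⟩ (by rw [Fin.lt_def]; simpa using hi'), zero_mul]
  let φ : (Fin h → K) →ₗ[K] (Fin k → K) :=
    (LinearMap.pi fun i : Fin k => (Polynomial.leval x).comp (derivative ^ (i : ℕ))).comp
      (Fintype.linearCombination K G)
  obtain ⟨w, hw, hw0⟩ := (Submodule.ne_bot_iff _).1
    (LinearMap.ker_ne_bot_of_finrank_lt (f := φ) (by simp))
  have hlin : ∑ l, w l • G l = ∑ l, C (w l) * G l := by simp [smul_eq_C_mul]
  have hzero : ∑ l, C (w l) * G l = 0 := by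
    refine eq_zero_of_differential_equation (k := k) c' x (by simpa [hc'] using hx) _ ?_ ?_
    · rw [← hsum]
      simp_rw [iterate_derivative_C_sum, Finset.mul_sum]
      rw [Finset.sum_comm]
      refine Finset.sum_eq_zero fun l _ => ?_
      have := congrFun hcG l
      simp only [Matrix.vecMul, dotProduct, wronskianMatrix, Matrix.of_apply,
        Pi.zero_apply] at this
      simp_rw [mul_left_comm _ (C (w l))]
      rw [← Finset.mul_sum, this, mul_zero]
    · intro i hi
      have := congrFun (LinearMap.mem_ker.1 hw) ⟨i, hi⟩
      rw [← hlin]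
      simpa only [φ, Fintype.linearCombination_apply, Module.End.pow_apply, LinearMap.comp_apply,
        LinearMap.pi_apply, leval_apply, Pi.zero_apply] using this
  exact hw0 (funext (Fintype.linearIndependent_iff.1 hG w (hlin.trans hzero)))

/-! ### The zero estimate -/

/-- In characteristic zero ξ is a simple root of its minimal polynomial, so stripping one factor
`minpoly K ξ` from `W` costs only one order of vanishing. -/
theorem minpoly_pow_dvd {K L : Type*} [Field K] [CharZero K] [Field L] [Algebra K L] {ξ : L}
    (hξ : IsIntegral K ξ) {s : ℕ} {W : K[X]}
    (h : (X - C ξ) ^ s ∣ W.map (algebraMap K L)) : minpoly K ξ ^ s ∣ W := by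
  induction s generalizing W with
  | zero => simp
  | succ s ih =>
    have hroot : X - C ξ ∣ W.map (algebraMap K L) := (dvd_pow_self _ (Nat.succ_ne_zero s)).trans h
    rw [dvd_iff_isRoot, IsRoot, eval_map_algebraMap] at hroot
    obtain ⟨V, rfl⟩ := minpoly.dvd K ξ hroot
    rw [pow_succ']
    refine mul_dvd_mul_left _ (ih ?_)
    have hsep := (minpoly.irreducible hξ).separable
    have hm : X - C ξ ∣ (minpoly K ξ).map (algebraMap K L) := by
      rw [dvd_iff_isRoot, IsRoot, eval_map_algebraMap, minpoly.aeval]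
    obtain ⟨g, hg⟩ := hm
    rw [Polynomial.map_mul, hg, pow_succ', mul_assoc] at h
    have h' := (mul_dvd_mul_iff_left (X_sub_C_ne_zero ξ)).1 h
    refine IsCoprime.dvd_of_dvd_mul_left (IsCoprime.pow_left ?_) h'
    have := hsep.map (f := algebraMap K L)
    rw [hg] at this
    exact this.isCoprime

theorem sum_pow_mul_map_eq {K M : Type*} [Field K] [Field M] [Algebra K M] {m h : ℕ}
    {F : Fin m → K[X]} {G : Fin h → K[X]} {c : Fin m → Fin h → K}
    (hc : ∀ j, F j = ∑ l, C (c j l) * G l) (z : M) :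
    ∑ j : Fin m, C (z ^ (j : ℕ)) * (F j).map (algebraMap K M) =
      ∑ l, C (∑ j : Fin m, z ^ (j : ℕ) * algebraMap K M (c j l)) *
        (G l).map (algebraMap K M) := by
  simp_rw [map_sum, Finset.sum_mul]
  rw [Finset.sum_comm]
  refine Finset.sum_congr rfl fun j _ => ?_
  rw [hc j]
  simp [Polynomial.map_sum, Finset.mul_sum, mul_assoc]

/-- Zero estimate for `∑ F j (x) y ^ j` at `(ξ, ξ)` and `(x, y)`. -/
theorem order_add_mul_order_le {L : Type*} [Field L] [Algebra ℚ L] {ξ : L} {m n r s k : ℕ}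
    (hξ : IsIntegral ℚ ξ) (hn : (minpoly ℚ ξ).natDegree = n) (hn2 : 2 ≤ n) (hmn : m ≤ n)
    (F : Fin m → ℚ[X]) (hF : ∀ j, (F j).natDegree ≤ r) (x y : ℚ)
    (hy : ∑ j : Fin m, C (y ^ (j : ℕ)) * F j ≠ 0)
    (hvξ : (X - C ξ) ^ (s + m) ∣ ∑ j : Fin m, C (ξ ^ (j : ℕ)) * (F j).map (algebraMap ℚ L))
    (hvx : (X - C x) ^ (k + m) ∣ ∑ j : Fin m, C (y ^ (j : ℕ)) * F j) :
    n * s + k ≤ m * r := by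
  -- The F j may be dependent, so the Wronskian is taken over a basis of their span. Its size h is
  -- at most m, which is why m spare orders of vanishing suffice.
  set V := Submodule.span ℚ (Set.range F) with hV
  have : Module.Finite ℚ V := Module.Finite.span_of_finite ℚ (Set.finite_range F)
  set h := Module.finrank ℚ V with hh
  let B := Module.finBasis ℚ V
  let G : Fin h → ℚ[X] := fun l => (B l : ℚ[X])
  have hG : LinearIndependent ℚ G := B.linearIndependent.map' V.subtype V.ker_subtype
  have hhm : h ≤ m := by
    simpa [Set.finrank] using finrank_range_le_card (R := ℚ) F
  let F' : Fin m → V := fun j => ⟨F j, Submodule.subset_span ⟨j, rfl⟩⟩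
  let c : Fin m → Fin h → ℚ := fun j l => B.repr (F' j) l
  have hc : ∀ j, F j = ∑ l, C (c j l) * G l := by
    intro j
    have := congrArg V.subtype (B.sum_repr (F' j))
    rw [map_sum] at this
    simp_rw [map_smul, smul_eq_C_mul] at this
    exact this.symm
  have hGdeg : ∀ l, (G l).natDegree ≤ r := by
    intro l
    have hle : V ≤ degreeLE ℚ r := by
      rw [hV, Submodule.span_le]
      rintro _ ⟨j, rfl⟩
      exact mem_degreeLE.2 (natDegree_le_iff_degree_le.1 (hF j))
    exact natDegree_le_iff_degree_le.2 (mem_degreeLE.1 (hle (B l).2))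
  have hcomby := sum_pow_mul_map_eq hc y
  simp only [Algebra.algebraMap_self, Polynomial.map_id, RingHom.id_apply] at hcomby
  have hW := det_wronskianMatrix_ne_zero G hG
  set W := (wronskianMatrix G).det with hWdef
  have hd1 : (X - C x) ^ k ∣ W := by
    refine pow_dvd_det_wronskianMatrix G (fun l => ∑ j : Fin m, y ^ (j : ℕ) * c j l) ?_ x ?_
    · intro h0
      refine hy (hcomby.trans (Finset.sum_eq_zero fun l _ => ?_))
      have := congrFun h0 l
      simp only [Pi.zero_apply] at this
      rw [this, C_0, zero_mul]
    · rw [← hcomby]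
      exact (pow_dvd_pow _ (by omega)).trans hvx
  have hd2 : minpoly ℚ ξ ^ s ∣ W := by
    refine minpoly_pow_dvd hξ ?_
    rw [hWdef, ← wronskianMatrix_map]
    refine pow_dvd_det_wronskianMatrix _
      (fun l => ∑ j : Fin m, ξ ^ (j : ℕ) * algebraMap ℚ L (c j l)) ?_ ξ ?_
    · intro h0
      apply hy
      rw [hcomby]
      refine Finset.sum_eq_zero fun l _ => ?_
      -- Here m ≤ n matters: 1, ξ, …, ξ^(m-1) are independent over ℚ.
      have hcl : ∀ j, c j l = 0 := by
        have hli := (linearIndependent_pow (K := ℚ) ξ).comp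
          (Fin.castLE (hmn.trans hn.ge)) (Fin.castLE_injective _)
        rw [Fintype.linearIndependent_iff] at hli
        refine hli (fun j => c j l) ?_
        have := congrFun h0 l
        simpa [Algebra.smul_def, mul_comm] using this
      simp [hcl]
    · rw [← sum_pow_mul_map_eq hc]
      exact (pow_dvd_pow _ (by omega)).trans hvξ
  have hcop : IsCoprime (minpoly ℚ ξ ^ s) ((X - C x) ^ k) := by
    refine IsCoprime.pow ?_
    rw [(minpoly.irreducible hξ).coprime_iff_not_dvd]
    intro hdvd
    have := natDegree_le_of_dvd hdvd (X_sub_C_ne_zero x)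
    rw [natDegree_X_sub_C] at this
    omega
  have hdeg := natDegree_le_of_dvd (hcop.mul_dvd hd2 hd1) hW
  rw [natDegree_mul (pow_ne_zero _ (minpoly.ne_zero hξ)) (pow_ne_zero _ (X_sub_C_ne_zero x)),
    natDegree_pow, natDegree_pow, natDegree_X_sub_C, hn] at hdeg
  have : W.natDegree ≤ h * r := natDegree_det_wronskianMatrix_le G hGdeg
  have : h * r ≤ m * r := Nat.mul_le_mul_right _ hhm
  rw [mul_comm n s]
  omega

/-! ### The auxiliary polynomial -/

theorem X_sub_C_pow_dvd_iff_hasseDeriv {K : Type*} [CommRing K] (p : K[X]) (x : K) (T : ℕ) :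
    (X - C x) ^ T ∣ p ↔ ∀ k < T, (hasseDeriv k p).eval x = 0 := by
  rw [X_sub_C_pow_dvd_iff, ← taylor_apply, X_pow_dvd_iff]
  simp_rw [taylor_coeff]

/-- The linear system expressing that `∑ c j i x ^ i ξ ^ j` vanishes at `ξ` to order `T`, where
`ξ ^ n = a / b`. -/
def siegelMatrix (n m a b R T : ℕ) : Matrix (Fin T × Fin n) (Fin m × Fin R) ℤ :=
  Matrix.of fun kρ ji =>
    if (ji.1 + ji.2 - kρ.1 : ℕ) % n = kρ.2 then
      ((ji.2 : ℕ).choose kρ.1 : ℤ) * a ^ ((ji.1 + ji.2 - kρ.1 : ℕ) / n) *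
        b ^ (R + m - (ji.1 + ji.2 - kρ.1 : ℕ) / n)
    else 0

theorem norm_siegelMatrix_le {n m a b R T : ℕ} (ha : 0 < a) (hb : 0 < b) :
    ‖siegelMatrix n m a b R T‖ ≤ 2 ^ R * (a * b : ℝ) ^ (R + m) := by
  have ha' : (1 : ℝ) ≤ a := by exact_mod_cast ha
  have hb' : (1 : ℝ) ≤ b := by exact_mod_cast hb
  rw [Matrix.norm_le_iff (by positivity)]
  rintro ⟨k, ρ⟩ ⟨j, i⟩
  rw [siegelMatrix, Matrix.of_apply]
  split_ifs with h
  · have hle : (j + i - k : ℕ) / n ≤ R + m := (Nat.div_le_self _ _).trans (by omega)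
    rw [mul_pow, ← mul_assoc]
    simp only [norm_mul, norm_pow, Int.norm_eq_abs, Int.cast_natCast, Nat.abs_cast]
    gcongr
    · have h1 : ((i : ℕ).choose k) ≤ 2 ^ R :=
        (Nat.choose_le_two_pow _ _).trans (Nat.pow_le_pow_right two_pos i.2.le)
      exact_mod_cast h1
    exact Nat.sub_le _ _
  · rw [norm_zero]
    positivity

/-- Solutions of the linear system give polynomials vanishing to high order. -/
theorem dvd_of_siegelMatrix_mulVec_eq_zero {n m a b R T : ℕ} (hn : 0 < n) (hb : 0 < b) {ξ : ℝ}
    (hξ : ξ ^ n = a / b) (c : Fin m × Fin R → ℤ)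
    (hc : (siegelMatrix n m a b R T).mulVec c = 0) :
    (X - C ξ) ^ T ∣ ∑ j : Fin m, C (ξ ^ (j : ℕ)) *
      (∑ i : Fin R, monomial (i : ℕ) (c (j, i))).map (Int.castRingHom ℝ) := by
  rw [X_sub_C_pow_dvd_iff_hasseDeriv]
  intro k hk
  have hbR : (b : ℝ) ≠ 0 := by exact_mod_cast hb.ne'
  have h1 : (hasseDeriv k (∑ j : Fin m, C (ξ ^ (j : ℕ)) *
      (∑ i : Fin R, monomial (i : ℕ) (c (j, i))).map (Int.castRingHom ℝ))).eval ξ =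
      ∑ ji : Fin m × Fin R, ((ji.2 : ℕ).choose k : ℝ) * c ji * ξ ^ (ji.1 + ji.2 - k : ℕ) := by
    rw [Fintype.sum_prod_type]
    simp only [map_sum, Polynomial.map_sum, map_monomial, Finset.mul_sum, C_mul_monomial,
      hasseDeriv_monomial, eval_finsetSum, eval_monomial]
    refine Finset.sum_congr rfl fun j _ => Finset.sum_congr rfl fun i _ => ?_
    -- For i < k the exponent j + i - k is not the right one, but the binomial coefficient is zero.
    rcases le_or_gt k i with hki | hki
    · rw [Nat.add_sub_assoc hki, pow_add, eq_intCast]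
      ring
    · simp [Nat.choose_eq_zero_of_lt hki]
  rw [h1]
  -- Reduce ξ^e to ξ^(e % n) (a/b)^(e / n) and clear denominators: the coefficients of the ξ^ρ are
  -- the rows of the integer system.
  have h2 : (b : ℝ) ^ (R + m) * ∑ ji : Fin m × Fin R,
      ((ji.2 : ℕ).choose k : ℝ) * c ji * ξ ^ (ji.1 + ji.2 - k : ℕ) =
      ∑ ρ : Fin n, ξ ^ (ρ : ℕ) *
        (((siegelMatrix n m a b R T).mulVec c (⟨k, hk⟩, ρ) : ℤ) : ℝ) := by
    simp only [Matrix.mulVec, dotProduct, siegelMatrix, Matrix.of_apply, Int.cast_sum,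
      Finset.mul_sum]
    rw [Finset.sum_comm]
    refine Finset.sum_congr rfl fun ji _ => ?_
    set e := (ji.1 + ji.2 - k : ℕ) with he
    rw [Finset.sum_eq_single ⟨e % n, Nat.mod_lt _ hn⟩]
    · have hle : e / n ≤ R + m := (Nat.div_le_self _ _).trans (by omega)
      have h3 : ξ ^ e = ξ ^ (e % n) * ((a : ℝ) / b) ^ (e / n) := by
        rw [← hξ, ← pow_mul, ← pow_add, Nat.mod_add_div]
      have h4 : (b : ℝ) ^ (R + m) = b ^ (R + m - e / n) * b ^ (e / n) := by
        rw [← pow_add, Nat.sub_add_cancel hle]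
      rw [if_pos rfl, h3, h4, div_pow]
      push_cast
      field_simp
    · intro ρ _ hρ
      rw [if_neg fun h => hρ (Fin.ext h.symm)]
      simp
    · simp
  rw [hc] at h2
  simpa [hbR] using h2

/-- Siegel's lemma with mR unknowns and nT equations, where R = (N+1)ns and T = Nms. The surplus is
mns, so the Siegel exponent nT/(mR - nT) equals N for every s, and the coefficients grow only
exponentially in s. -/
theorem exists_auxiliary_polynomial {n m a b N : ℕ} (hn : 0 < n) (hm : 0 < m) (hN : 0 < N)
    (ha : 0 < a) (hb : 0 < b) {ξ : ℝ} (hξ : ξ ^ n = a / b) :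
    ∃ M : ℝ, 1 ≤ M ∧ ∀ s : ℕ, 1 ≤ s → ∃ F : Fin m → ℤ[X], F ≠ 0 ∧
      (∀ j, (F j).natDegree ≤ (N + 1) * n * s) ∧ (∀ j i, |((F j).coeff i : ℝ)| ≤ M ^ s) ∧
      (X - C ξ) ^ (N * m * s) ∣
        ∑ j : Fin m, C (ξ ^ (j : ℕ)) * (F j).map (Int.castRingHom ℝ) := by
  have hab : (1 : ℝ) ≤ a * b := by exact_mod_cast Nat.mul_pos ha hb
  set R₀ := (N + 1) * n with hR₀
  -- `D ^ s` bounds the number mR of unknowns times the largest matrix entry, using mR ≤ 2^(mR).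
  set D : ℝ := 2 ^ (m * R₀) * (2 ^ R₀ * (a * b : ℝ) ^ (R₀ + m)) with hD
  have hD1 : 1 ≤ D := one_le_mul_of_one_le_of_one_le (one_le_pow₀ one_le_two)
    (one_le_mul_of_one_le_of_one_le (one_le_pow₀ one_le_two) (one_le_pow₀ hab))
  refine ⟨D ^ N, one_le_pow₀ hD1, fun s hs => ?_⟩
  set R := R₀ * s with hR
  set T := N * m * s with hT
  have hRpos : 0 < R := by positivity
  have hcardβ : Fintype.card (Fin m × Fin R) = m * R := by simp
  have hcardα : Fintype.card (Fin T × Fin n) = T * n := by simp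
  have hTn : m * R = T * n + m * n * s := by rw [hR, hR₀, hT]; ring
  have hmns : 0 < m * n * s := by positivity
  obtain ⟨c, hc0, hc, hcle⟩ := Int.Matrix.exists_ne_zero_int_vec_norm_le
    (siegelMatrix n m a b R T) (by rw [hcardα, hcardβ]; omega) (by rw [hcardα]; positivity)
  have hexp : (Fintype.card (Fin T × Fin n) : ℝ) /
      (Fintype.card (Fin m × Fin R) - Fintype.card (Fin T × Fin n)) = N := by
    rw [hcardα, hcardβ, hTn, hT]
    have : (m : ℝ) * n * s ≠ 0 := by exact_mod_cast hmns.ne'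
    push_cast
    rw [add_sub_cancel_left, div_eq_iff this]
    ring
  rw [hexp, Real.rpow_natCast, hcardβ] at hcle
  have hbound : ((m * R : ℕ) : ℝ) * max 1 ‖siegelMatrix n m a b R T‖ ≤ D ^ s := by
    rw [hD, mul_pow]
    gcongr
    · rw [← pow_mul, mul_assoc, ← hR]
      exact_mod_cast Nat.lt_two_pow_self.le
    · refine max_le ?_ ((norm_siegelMatrix_le ha hb).trans ?_)
      · exact one_le_pow₀ (one_le_mul_of_one_le_of_one_le (one_le_pow₀ one_le_two)
          (one_le_pow₀ hab))
      · rw [mul_pow (2 ^ R₀ : ℝ), ← pow_mul, ← pow_mul, ← hR]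
        gcongr
        rw [add_mul]
        exact Nat.add_le_add_left (Nat.le_mul_of_pos_right m hs) _
  have hcle' : ‖c‖ ≤ (D ^ N) ^ s := by
    refine hcle.trans ((pow_le_pow_left₀ (by positivity) hbound N).trans_eq ?_)
    rw [← pow_mul, ← pow_mul, mul_comm]
  have hcoeff : ∀ j i, (∑ i : Fin R, monomial (i : ℕ) (c (j, i)) : ℤ[X]).coeff i =
      if hi : i < R then c (j, ⟨i, hi⟩) else 0 := by
    intro j i
    simp only [finsetSum_coeff, coeff_monomial]
    split_ifs with hi
    · rw [Finset.sum_eq_single ⟨i, hi⟩]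
      · simp
      · exact fun l _ hl => if_neg fun h => hl (Fin.ext h)
      · simp
    · exact Finset.sum_eq_zero fun l _ => if_neg fun h : (l : ℕ) = i => hi (h ▸ l.2)
  refine ⟨fun j => ∑ i : Fin R, monomial (i : ℕ) (c (j, i)), ?_, ?_, ?_, ?_⟩
  · obtain ⟨⟨j, i⟩, hji⟩ := Function.ne_iff.1 hc0
    intro h
    have := congrArg (fun p : ℤ[X] => p.coeff i) (congrFun h j)
    simp only [hcoeff, i.2, dif_pos] at this
    exact hji (by simpa using this)
  · exact fun j => natDegree_sum_le_of_forall_le _ _ fun i _ =>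
      (natDegree_monomial_le _).trans i.2.le
  · intro j i
    rw [hcoeff]
    split_ifs with hi
    · have := (norm_le_pi_norm c (j, ⟨i, hi⟩)).trans hcle'
      rwa [Int.norm_eq_abs] at this
    · rw [Int.cast_zero, abs_zero]
      positivity
  · exact dvd_of_siegelMatrix_mulVec_eq_zero hn hb hξ c hc

/-! ### Upper and lower bounds for values -/

theorem coeff_hasseDeriv_abs_le {p : ℝ[X]} {R : ℕ} {B : ℝ} (hR : p.natDegree ≤ R)
    (hB : ∀ i, |p.coeff i| ≤ B) (k i : ℕ) : |(hasseDeriv k p).coeff i| ≤ 2 ^ R * B := by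
  have hB0 : 0 ≤ B := (abs_nonneg _).trans (hB 0)
  rw [hasseDeriv_coeff]
  rcases le_or_gt (i + k) R with h | h
  · rw [abs_mul, Nat.abs_cast]
    gcongr
    · have h1 : (i + k).choose k ≤ 2 ^ R :=
        (Nat.choose_le_two_pow _ _).trans (Nat.pow_le_pow_right two_pos h)
      exact_mod_cast h1
    · exact hB _
  · rw [coeff_eq_zero_of_natDegree_lt (hR.trans_lt h)]
    simpa using by positivity

theorem abs_eval_le {p : ℝ[X]} {R : ℕ} {B A x : ℝ} (hR : p.natDegree ≤ R)
    (hB : ∀ i, |p.coeff i| ≤ B) (hA : 1 ≤ A) (hx : |x| ≤ A) :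
    |p.eval x| ≤ (R + 1) * (B * A ^ R) := by
  have hB0 : 0 ≤ B := (abs_nonneg _).trans (hB 0)
  rw [eval_eq_sum_range' (Nat.lt_succ_of_le hR)]
  refine (Finset.abs_sum_le_sum_abs _ _).trans ((Finset.sum_le_card_nsmul _ _ (B * A ^ R)
    fun i hi => ?_).trans (by simp))
  rw [abs_mul, abs_pow]
  have hi' := Nat.lt_succ_iff.1 (Finset.mem_range.1 hi)
  gcongr
  · exact hB i
  · exact (pow_le_pow_left₀ (abs_nonneg _) hx i).trans (pow_le_pow_right₀ hA hi')

theorem natDegree_hasseDeriv_le_of_le {p : ℝ[X]} {R : ℕ} (hR : p.natDegree ≤ R) (k : ℕ) :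
    (hasseDeriv k p).natDegree ≤ R :=
  (natDegree_hasseDeriv_le p k).trans ((Nat.sub_le _ _).trans hR)

theorem abs_eval_hasseDeriv_le {p : ℝ[X]} {R : ℕ} {B A x : ℝ} (hR : p.natDegree ≤ R)
    (hB : ∀ i, |p.coeff i| ≤ B) (hA : 1 ≤ A) (hx : |x| ≤ A) (k : ℕ) :
    |(hasseDeriv k p).eval x| ≤ (R + 1) * (2 ^ R * B * A ^ R) :=
  abs_eval_le (natDegree_hasseDeriv_le_of_le hR k) (coeff_hasseDeriv_abs_le hR hB k) hA hx

/-- A polynomial vanishing at `ξ` to high order has small derivatives near `ξ`. -/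
theorem abs_eval_hasseDeriv_le_pow {p : ℝ[X]} {R T : ℕ} {B A x ξ : ℝ} (hR : p.natDegree ≤ R)
    (hB : ∀ i, |p.coeff i| ≤ B) (hA : 1 ≤ A) (hξ : |ξ| ≤ A) (hx : |x - ξ| ≤ 1)
    (hdvd : (X - C ξ) ^ T ∣ p) (k : ℕ) :
    |(hasseDeriv k p).eval x| ≤
      |x - ξ| ^ (T - k) * ((R + 1) * ((R + 1) * (2 ^ R * (2 ^ R * B) * A ^ R))) := by
  have hB0 : 0 ≤ B := (abs_nonneg _).trans (hB 0)
  rw [X_sub_C_pow_dvd_iff_hasseDeriv] at hdvd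
  have h1 : (hasseDeriv k p).eval x = (taylor ξ (hasseDeriv k p)).eval (x - ξ) := by
    rw [taylor_eval, sub_add_cancel]
  rw [h1, eval_eq_sum_range' (n := R + 1)
    (by rw [natDegree_taylor]; exact Nat.lt_succ_of_le (natDegree_hasseDeriv_le_of_le hR k))]
  set E := (R + 1 : ℝ) * (2 ^ R * (2 ^ R * B) * A ^ R) with hE
  have hE0 : 0 ≤ E := by positivity
  refine (Finset.abs_sum_le_sum_abs _ _).trans ((Finset.sum_le_card_nsmul _ _
    (|x - ξ| ^ (T - k) * E) fun i _ => ?_).trans (by simp; apply le_of_eq; ring))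
  rw [taylor_coeff, abs_mul, abs_pow]
  -- Iterated Hasse derivatives are multiples of the one of order i + k, so Taylor coefficients with
  -- i + k < T vanish.
  rcases lt_or_ge (i + k) T with h | h
  · have : (hasseDeriv i (hasseDeriv k p)).eval ξ = 0 := by
      have h2 := LinearMap.congr_fun (hasseDeriv_comp (R := ℝ) i k) p
      rw [LinearMap.comp_apply] at h2
      rw [h2, LinearMap.smul_apply, eval_smul, hdvd _ h, smul_zero]
    rw [this, abs_zero, zero_mul]
    positivity
  · rw [mul_comm]
    refine mul_le_mul (pow_le_pow_of_le_one (abs_nonneg _) hx (by omega)) ?_ (abs_nonneg _)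
      (by positivity)
    exact abs_eval_hasseDeriv_le (natDegree_hasseDeriv_le_of_le hR k)
        (coeff_hasseDeriv_abs_le hR hB k) hA hξ i

theorem exists_int_eq_pow_mul_eval {p : ℤ[X]} {R : ℕ} (hR : p.natDegree ≤ R) (u q : ℤ)
    (hq : q ≠ 0) :
    ∃ z : ℤ, (z : ℝ) = (q : ℝ) ^ R * (p.map (Int.castRingHom ℝ)).eval ((u : ℝ) / q) := by
  have hq' : (q : ℝ) ≠ 0 := by exact_mod_cast hq
  obtain ⟨D, bi, hbi, hD⟩ := denomsClearable_of_natDegree_le (i := Int.castRingHom ℝ) (b := q)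
    (bi := (q : ℝ)⁻¹) R u (by simp [hq']) p hR
  simp only [eq_intCast] at hbi hD
  rw [eq_inv_of_mul_eq_one_left hbi, ← div_eq_mul_inv] at hD
  exact ⟨D, hD⟩

/-- The Liouville lower bound in two variables. -/
theorem one_le_mul_abs_sum {m R k : ℕ} (F : Fin m → ℤ[X]) (hR : ∀ j, (F j).natDegree ≤ R)
    (p₁ q₁ p₂ q₂ : ℤ) (hq₁ : 0 < q₁) (hq₂ : 0 < q₂)
    (hne : ∑ j : Fin m, ((p₂ : ℝ) / q₂) ^ (j : ℕ) *
      (hasseDeriv k ((F j).map (Int.castRingHom ℝ))).eval ((p₁ : ℝ) / q₁) ≠ 0) :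
    1 ≤ (q₁ : ℝ) ^ R * (q₂ : ℝ) ^ (m - 1) * |∑ j : Fin m, ((p₂ : ℝ) / q₂) ^ (j : ℕ) *
      (hasseDeriv k ((F j).map (Int.castRingHom ℝ))).eval ((p₁ : ℝ) / q₁)| := by
  have h1 : (0 : ℝ) < q₁ := by exact_mod_cast hq₁
  have h2 : (0 : ℝ) < q₂ := by exact_mod_cast hq₂
  have hz : ∀ j, ∃ z : ℤ, (z : ℝ) = (q₁ : ℝ) ^ R *
      (hasseDeriv k ((F j).map (Int.castRingHom ℝ))).eval ((p₁ : ℝ) / q₁) := by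
    intro j
    have hmap : hasseDeriv k ((F j).map (Int.castRingHom ℝ)) =
        (hasseDeriv k (F j)).map (Int.castRingHom ℝ) := by
      ext i
      simp [hasseDeriv_coeff]
    rw [hmap]
    exact exists_int_eq_pow_mul_eval
      ((natDegree_hasseDeriv_le _ k).trans ((Nat.sub_le _ _).trans (hR j))) p₁ q₁ hq₁.ne'
  choose z hz using hz
  set S := ∑ j : Fin m, ((p₂ : ℝ) / q₂) ^ (j : ℕ) *
      (hasseDeriv k ((F j).map (Int.castRingHom ℝ))).eval ((p₁ : ℝ) / q₁) with hS
  have hint : (q₁ : ℝ) ^ R * (q₂ : ℝ) ^ (m - 1) * S =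
      ((∑ j : Fin m, z j * p₂ ^ (j : ℕ) * q₂ ^ (m - 1 - j) : ℤ) : ℝ) := by
    rw [hS, Finset.mul_sum]
    push_cast
    refine Finset.sum_congr rfl fun j _ => ?_
    have h3 : (q₂ : ℝ) ^ (m - 1) = q₂ ^ (m - 1 - j : ℕ) * q₂ ^ (j : ℕ) := by
      rw [← pow_add, Nat.sub_add_cancel (by omega)]
    rw [hz, h3, div_pow]
    field_simp
  have hne' : (q₁ : ℝ) ^ R * (q₂ : ℝ) ^ (m - 1) * S ≠ 0 := by positivity
  have habs : (q₁ : ℝ) ^ R * (q₂ : ℝ) ^ (m - 1) * |S| =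
      |(q₁ : ℝ) ^ R * (q₂ : ℝ) ^ (m - 1) * S| := by
    rw [abs_mul, abs_of_nonneg (by positivity : 0 ≤ (q₁ : ℝ) ^ R * (q₂ : ℝ) ^ (m - 1))]
  rw [habs, hint]
  rw [hint] at hne'
  exact_mod_cast Int.one_le_abs (by exact_mod_cast hne')

/-- The upper bound for the value of the auxiliary polynomial near `(ξ, ξ)`. -/
theorem abs_sum_le {m R T k : ℕ} (F : Fin m → ℝ[X]) (hR : ∀ j, (F j).natDegree ≤ R)
    {A B x y ξ : ℝ} (hA : 1 ≤ A) (hB : ∀ j i, |(F j).coeff i| ≤ B) (hB0 : 0 ≤ B)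
    (hx : |x| ≤ A) (hy : |y| ≤ A) (hξ : |ξ| ≤ A) (hxξ : |x - ξ| ≤ 1)
    (hdvd : (X - C ξ) ^ T ∣ ∑ j : Fin m, C (ξ ^ (j : ℕ)) * F j) :
    |∑ j : Fin m, y ^ (j : ℕ) * (hasseDeriv k (F j)).eval x| ≤
      (m ^ 2 * A ^ m * (16 * A) ^ R * B) * (|x - ξ| ^ (T - k) + |y - ξ|) := by
  set g := ∑ j : Fin m, C (ξ ^ (j : ℕ)) * F j with hg
  have hpow : ∀ j : Fin m, A ^ (j : ℕ) ≤ A ^ m := fun j => pow_le_pow_right₀ hA j.2.le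
  have hR4 : (R + 1 : ℝ) ≤ 2 ^ R := by exact_mod_cast Nat.lt_two_pow_self
  have hgdeg : g.natDegree ≤ R := natDegree_sum_le_of_forall_le _ _ fun j _ =>
    (natDegree_C_mul_le _ _).trans (hR j)
  have hgcoeff : ∀ i, |g.coeff i| ≤ m * (A ^ m * B) := by
    intro i
    rw [hg, finsetSum_coeff]
    refine (Finset.abs_sum_le_sum_abs _ _).trans ((Finset.sum_le_card_nsmul _ _ (A ^ m * B)
      fun j _ => ?_).trans (by simp))
    rw [coeff_C_mul, abs_mul, abs_pow]
    gcongr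
    · exact (pow_le_pow_left₀ (abs_nonneg _) hξ _).trans (hpow j)
    · exact hB j i
  -- Replacing y by ξ isolates the part that is small by vanishing; the error is of size |y - ξ|.
  have hsplit : ∑ j : Fin m, y ^ (j : ℕ) * (hasseDeriv k (F j)).eval x =
      (hasseDeriv k g).eval x +
        ∑ j : Fin m, (y ^ (j : ℕ) - ξ ^ (j : ℕ)) * (hasseDeriv k (F j)).eval x := by
    have h1 : (hasseDeriv k g).eval x =
        ∑ j : Fin m, ξ ^ (j : ℕ) * (hasseDeriv k (F j)).eval x := by
      simp only [hg, map_sum, ← smul_eq_C_mul, map_smul, eval_finsetSum, eval_smul, smul_eq_mul]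
    rw [h1, ← Finset.sum_add_distrib]
    exact Finset.sum_congr rfl fun j _ => by ring
  have hfirst := abs_eval_hasseDeriv_le_pow hgdeg hgcoeff hA hξ hxξ hdvd k
  have hsecond : |∑ j : Fin m, (y ^ (j : ℕ) - ξ ^ (j : ℕ)) * (hasseDeriv k (F j)).eval x| ≤
      m * ((|y - ξ| * m * A ^ m) * ((R + 1) * (2 ^ R * B * A ^ R))) := by
    refine (Finset.abs_sum_le_sum_abs _ _).trans ((Finset.sum_le_card_nsmul _ _
      ((|y - ξ| * m * A ^ m) * ((R + 1) * (2 ^ R * B * A ^ R))) fun j _ => ?_).trans (by simp))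
    rw [abs_mul]
    gcongr
    · refine (abs_pow_sub_pow_le _ _ _).trans ?_
      gcongr
      · exact j.2.le
      · exact (pow_le_pow_left₀ (by positivity) (max_le hy hξ) _).trans
          (pow_le_pow_right₀ hA (by omega))
    · exact abs_eval_hasseDeriv_le (hR j) (hB j) hA hx k
  have hm2 : (m : ℝ) ≤ m ^ 2 := by exact_mod_cast Nat.le_self_pow two_ne_zero m
  -- Four factors 2^R: two absorb R + 1 and two come from binomial coefficients.
  have h16 : (16 * A) ^ R = (2 ^ R * 2 ^ R * 2 ^ R * 2 ^ R * A ^ R : ℝ) := by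
    rw [← mul_pow, ← mul_pow, ← mul_pow, ← mul_pow]
    norm_num
  have h2R : (1 : ℝ) ≤ 2 ^ R := one_le_pow₀ one_le_two
  rw [hsplit, mul_add]
  refine (abs_add_le _ _).trans (add_le_add (hfirst.trans ?_) (hsecond.trans ?_))
  · rw [mul_comm, h16]
    refine mul_le_mul_of_nonneg_right ?_ (by positivity)
    calc (R + 1 : ℝ) * ((R + 1) * (2 ^ R * (2 ^ R * (m * (A ^ m * B))) * A ^ R))
        ≤ 2 ^ R * (2 ^ R * (2 ^ R * (2 ^ R * (m ^ 2 * (A ^ m * B))) * A ^ R)) := by gcongr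
      _ = _ := by ring
  · calc m * ((|y - ξ| * m * A ^ m) * ((R + 1) * (2 ^ R * B * A ^ R)))
        ≤ m * ((|y - ξ| * m * A ^ m) * (2 ^ R * (2 ^ R * B * A ^ R))) := by gcongr
      _ = m ^ 2 * A ^ m * (1 * 1 * 2 ^ R * 2 ^ R * A ^ R) * B * |y - ξ| := by ring
      _ ≤ m ^ 2 * A ^ m * (16 * A) ^ R * B * |y - ξ| := by rw [h16]; gcongr

/-! ### The two-approximation inequality -/

/-- If the sum vanished, y would be a root of a nonzero integer polynomial formed from the
coefficients of one X^i. By the rational root theorem `y.den` divides its leading coefficient, which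
is too small. -/
theorem sum_C_pow_mul_ne_zero {m : ℕ} (F : Fin m → ℤ[X]) (hF : F ≠ 0) {B : ℝ}
    (hB : ∀ j i, |((F j).coeff i : ℝ)| ≤ B) (y : ℚ) (hy : B < y.den) :
    ∑ j : Fin m, C (y ^ (j : ℕ)) * (F j).map (Int.castRingHom ℚ) ≠ 0 := by
  intro h0
  obtain ⟨j₀, hj₀⟩ := Function.ne_iff.1 hF
  obtain ⟨i, hi⟩ : ∃ i, (F j₀).coeff i ≠ 0 := by
    by_contra! h
    exact hj₀ (Polynomial.ext h)
  set P : ℤ[X] := ∑ j : Fin m, monomial (j : ℕ) ((F j).coeff i) with hP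
  have hcoeff : ∀ j : Fin m, P.coeff j = (F j).coeff i := by
    intro j
    rw [hP, finsetSum_coeff, Finset.sum_eq_single j]
    · simp
    · exact fun l _ hl => by rw [coeff_monomial, if_neg fun h => hl (Fin.ext h)]
    · simp
  have hPne : P ≠ 0 := fun h => hi (by rw [← hcoeff, h, coeff_zero])
  have hroot : aeval y P = 0 := by
    have := congrArg (fun p : ℚ[X] => p.coeff i) h0
    simp only [finsetSum_coeff, coeff_C_mul, coeff_map, coeff_zero] at this
    simpa [hP, aeval_monomial, mul_comm] using this
  have hdvd := Int.natAbs_dvd_natAbs.2 (den_dvd_of_is_root hroot)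
  rw [Rat.isFractionRingDen] at hdvd
  have hlt : P.natDegree < m := by
    by_contra! h
    refine hPne (leadingCoeff_eq_zero.1 ?_)
    rw [leadingCoeff, hP, finsetSum_coeff]
    exact Finset.sum_eq_zero fun j _ => coeff_monomial_of_ne _ (by rw [← hP]; omega)
  have hle := Nat.le_of_dvd (Int.natAbs_pos.2 (leadingCoeff_ne_zero.2 hPne)) hdvd
  have hlc : P.leadingCoeff = (F ⟨P.natDegree, hlt⟩).coeff i := hcoeff ⟨P.natDegree, hlt⟩
  have h1 := hB ⟨P.natDegree, hlt⟩ i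
  rw [← hlc, ← Int.cast_abs, Int.abs_eq_natAbs, Int.cast_natCast] at h1
  have h2 : (y.den : ℝ) ≤ P.leadingCoeff.natAbs := by exact_mod_cast hle
  linarith

theorem hasseDeriv_map {R S : Type*} [CommRing R] [CommRing S] (φ : R →+* S) (p : R[X]) (k : ℕ) :
    hasseDeriv k (p.map φ) = (hasseDeriv k p).map φ := by
  ext i
  simp [hasseDeriv_coeff]

/-- The Thue–Siegel inequality: two approximations of `ξ` cannot both be too good. -/
theorem exists_thue_siegel_constant {n m a b N : ℕ} (hn : 2 ≤ n) (hm : 0 < m) (hmn : m ≤ n)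
    (hN : 0 < N) (ha : 0 < a) (hb : 0 < b) {ξ : ℝ} (hξ : ξ ^ n = a / b)
    (hdeg : (minpoly ℚ ξ).natDegree = n) :
    ∃ M : ℝ, 1 ≤ M ∧ ∀ s : ℕ, 1 ≤ s → ∀ x y : ℚ, |ξ - x| ≤ 1 → |ξ - y| ≤ 1 → M ^ s < y.den →
      1 ≤ M ^ s * (x.den : ℝ) ^ ((N + 1) * n * s) * (y.den : ℝ) ^ (m - 1) *
        (|ξ - x| ^ (N * m * s - (m * n * s + n * m + m)) + |ξ - y|) := by
  obtain ⟨M₀, hM₀, hF⟩ := exists_auxiliary_polynomial (N := N) (by omega) hm hN ha hb hξ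
  have hint : IsIntegral ℚ ξ := by
    by_contra h
    rw [minpoly.eq_zero h, natDegree_zero] at hdeg
    omega
  set A := |ξ| + 1 with hA
  have hA1 : 1 ≤ A := le_add_of_nonneg_left (abs_nonneg _)
  have hm1 : (1 : ℝ) ≤ m := by exact_mod_cast hm
  have hD : 1 ≤ (m : ℝ) ^ 2 * A ^ m := one_le_mul_of_one_le_of_one_le (one_le_pow₀ hm1)
    (one_le_pow₀ hA1)
  have hE : 1 ≤ (16 * A) ^ ((N + 1) * n) := one_le_pow₀ (by linarith)
  set M := (m : ℝ) ^ 2 * A ^ m * (16 * A) ^ ((N + 1) * n) * M₀ with hM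
  have hM₀M : M₀ ≤ M := le_mul_of_one_le_left (by linarith) (one_le_mul_of_one_le_of_one_le hD hE)
  refine ⟨M, hM₀.trans hM₀M, fun s hs x y hx hy hys => ?_⟩
  obtain ⟨F, hF0, hFdeg, hFcoeff, hFdvd⟩ := hF s hs
  set R := (N + 1) * n * s with hR
  set T := N * m * s with hT
  have hmT : m ≤ T := by
    have : 1 ≤ N * s := Nat.mul_pos hN hs
    calc m = m * 1 := (mul_one m).symm
      _ ≤ m * (N * s) := Nat.mul_le_mul_left m this
      _ = T := by rw [hT]; ring
  set g : ℚ[X] := ∑ j : Fin m, C (y ^ (j : ℕ)) * (F j).map (Int.castRingHom ℚ) with hg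
  have hg0 : g ≠ 0 := sum_C_pow_mul_ne_zero F hF0 hFcoeff y
    ((pow_le_pow_left₀ (by linarith) hM₀M s).trans_lt hys)
  have hmapmap : ∀ j, ((F j).map (Int.castRingHom ℚ)).map (algebraMap ℚ ℝ) =
      (F j).map (Int.castRingHom ℝ) := by
    intro j
    rw [Polynomial.map_map]
    congr 1
  -- Since mR = nT + mns, the zero estimate with orders T - m and mns + nm + 1 would fail by exactly
  -- one.
  obtain ⟨k, hk, hgk⟩ : ∃ k < m * n * s + n * m + 1 + m, (hasseDeriv k g).eval x ≠ 0 := by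
    by_contra! h
    have := order_add_mul_order_le (s := T - m) (k := m * n * s + n * m + 1) hint hdeg hn hmn
      (fun j => (F j).map (Int.castRingHom ℚ)) (fun j => natDegree_map_le.trans (hFdeg j)) x y
      hg0 (by simpa only [hmapmap, Nat.sub_add_cancel hmT] using hFdvd)
      ((X_sub_C_pow_dvd_iff_hasseDeriv _ _ _).2 h)
    have h1 : m * R = n * T + m * n * s := by rw [hR, hT]; ring
    have h2 : n * (T - m) + n * m = n * T := by rw [← mul_add, Nat.sub_add_cancel hmT]
    omega
  have hcast : (((hasseDeriv k g).eval x : ℚ) : ℝ) = ∑ j : Fin m, (y : ℝ) ^ (j : ℕ) *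
      (hasseDeriv k ((F j).map (Int.castRingHom ℝ))).eval (x : ℝ) := by
    have h1 : (((hasseDeriv k g).eval x : ℚ) : ℝ) =
        ((hasseDeriv k g).map (algebraMap ℚ ℝ)).eval (algebraMap ℚ ℝ x) := by
      rw [eval_map, eval₂_hom]
      rfl
    rw [h1, ← hasseDeriv_map, hg]
    simp only [Polynomial.map_sum, map_sum, eval_finsetSum]
    refine Finset.sum_congr rfl fun j _ => ?_
    rw [Polynomial.map_mul, map_C, hmapmap, ← smul_eq_C_mul, map_smul, eval_smul]
    simp
  have hne : ∑ j : Fin m, (y : ℝ) ^ (j : ℕ) *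
      (hasseDeriv k ((F j).map (Int.castRingHom ℝ))).eval (x : ℝ) ≠ 0 := by
    rw [← hcast]
    exact_mod_cast hgk
  have hxA : |(x : ℝ)| ≤ A := by
    have := abs_sub_abs_le_abs_sub (x : ℝ) ξ
    rw [abs_sub_comm] at this
    linarith
  have hyA : |(y : ℝ)| ≤ A := by
    have := abs_sub_abs_le_abs_sub (y : ℝ) ξ
    rw [abs_sub_comm] at this
    linarith
  have hupper := abs_sum_le (k := k) (fun j => (F j).map (Int.castRingHom ℝ))
    (fun j => natDegree_map_le.trans (hFdeg j)) (B := M₀ ^ s) hA1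
    (fun j i => by simpa using hFcoeff j i) (by positivity) hxA hyA
    (by linarith) (by rwa [abs_sub_comm]) hFdvd
  have hlower := one_le_mul_abs_sum (k := k) F hFdeg x.num x.den y.num y.den
    (by exact_mod_cast x.pos) (by exact_mod_cast y.pos)
    (by simpa only [Int.cast_natCast, ← Rat.cast_def] using hne)
  simp only [Int.cast_natCast, ← Rat.cast_def] at hlower
  have hconst : (m : ℝ) ^ 2 * A ^ m * (16 * A) ^ R * M₀ ^ s ≤ M ^ s := by
    rw [hM, mul_pow _ M₀, mul_pow (_ * _) (_ ^ ((N + 1) * n)), ← pow_mul, ← hR]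
    gcongr
    exact le_self_pow₀ hD (by omega)
  rw [abs_sub_comm (x : ℝ), abs_sub_comm (y : ℝ)] at hupper
  calc (1 : ℝ) ≤ _ := hlower
    _ ≤ (x.den : ℝ) ^ R * (y.den : ℝ) ^ (m - 1) * (M ^ s *
        (|ξ - x| ^ (T - (m * n * s + n * m + m)) + |ξ - y|)) := by
      refine mul_le_mul_of_nonneg_left (hupper.trans ?_) (by positivity)
      refine mul_le_mul hconst (add_le_add_left ?_ _) (by positivity) (by positivity)
      exact pow_le_pow_of_le_one (abs_nonneg _) hx (by omega)
    _ = _ := by ring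

/-! ### Finiteness -/

theorem finite_setOf_le_of_abs_sub_le (ξ : ℝ) (Q : ℝ) :
    {pq : ℤ × ℤ | 0 < pq.2 ∧ (pq.2 : ℝ) ≤ Q ∧ |ξ - (pq.1 : ℝ) / pq.2| ≤ 1}.Finite := by
  refine ((Set.finite_Icc (-⌈(|ξ| + 1) * Q⌉) ⌈(|ξ| + 1) * Q⌉).prod
    (Set.finite_Icc 0 ⌈Q⌉)).subset ?_
  rintro ⟨p, q⟩ ⟨hq, hqQ, hpq⟩
  simp only at hq hqQ hpq
  have hq' : (0 : ℝ) < q := by exact_mod_cast hq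
  have h1 : |(p : ℝ)| ≤ (|ξ| + 1) * Q := by
    have h2 := abs_sub_abs_le_abs_sub ((p : ℝ) / q) ξ
    rw [abs_sub_comm, abs_div, abs_of_pos hq'] at h2
    have h3 : |(p : ℝ)| / q ≤ |ξ| + 1 := by linarith
    rw [div_le_iff₀ hq'] at h3
    exact h3.trans (by gcongr)
  have h4 : |p| ≤ ⌈(|ξ| + 1) * Q⌉ := by
    have := h1.trans (Int.le_ceil _)
    exact_mod_cast this
  refine ⟨abs_le.1 h4, hq.le, ?_⟩
  exact_mod_cast hqQ.trans (Int.le_ceil _)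

theorem exists_den_gt_of_infinite {ξ : ℝ} {S : Set ℚ} (hS : S.Infinite)
    (h : ∀ x ∈ S, |ξ - x| ≤ 1) (Q : ℝ) : ∃ x ∈ S, Q < x.den := by
  by_contra! hQ
  refine hS (Set.Finite.of_finite_image (f := fun x : ℚ => (x.num, (x.den : ℤ)))
    ((finite_setOf_le_of_abs_sub_le ξ Q).subset ?_) ?_)
  · rintro _ ⟨x, hx, rfl⟩
    refine ⟨Int.natCast_pos.2 x.pos, by simpa using hQ x hx, ?_⟩
    simpa only [Int.cast_natCast, ← Rat.cast_def] using h x hx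
  · intro x _ y _ hxy
    simp only [Prod.mk.injEq, Nat.cast_inj] at hxy
    exact Rat.ext hxy.1 hxy.2

/-- The exponent comparison at the heart of the Thue–Siegel argument. -/
theorem thue_siegel_exponent_le {n m N s θ ε : ℝ} (hm : 0 < m) (hθ : θ = n / m + m - 1 + ε)
    (hs : 0 ≤ s) (hN : n + θ * m * n + 2 ≤ ε * N * m)
    (hs0 : N * m * (m - 1) + θ * (n * m + m) ≤ s) :
    (N + 1) * n * s + N * m * (s + 1) * (m - 1) +
      -θ * (N * m * s - (m * n * s + n * m + m)) ≤ -s := by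
  -- The Ns terms cancel down to -εm. The 2 in `hN` then leaves -2s, and `hs0` spends one s on the
  -- terms free of s.
  have h1 : θ * m = n + m * (m - 1) + ε * m := by
    rw [hθ]
    field_simp
    ring
  have h2 : θ * (N * m * s) = N * s * (n + m * (m - 1) + ε * m) := by
    rw [← h1]
    ring
  have h3 := mul_le_mul_of_nonneg_right hN hs
  linarith

/-- Infinitely many solutions would supply x with denominator above 2M, then y with a far larger
denominator. The constant M depends on N but not on s, so s may be fitted to y afterwards. -/
theorem finite_rat_approximations {n m a b : ℕ} (hn : 2 ≤ n) (hm : 0 < m) (hmn : m ≤ n)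
    (ha : 0 < a) (hb : 0 < b) {ξ : ℝ} (hξ : ξ ^ n = a / b)
    (hdeg : (minpoly ℚ ξ).natDegree = n) {ε θ : ℝ} (hε : 0 < ε) (hθ0 : 0 < θ)
    (hθ : θ = n / m + m - 1 + ε) :
    {x : ℚ | |ξ - x| ≤ (x.den : ℝ) ^ (-θ)}.Finite := by
  by_contra hS
  have hmR : (0 : ℝ) < m := by exact_mod_cast hm
  have hden : ∀ x : ℚ, (1 : ℝ) ≤ x.den := fun x => by exact_mod_cast x.pos
  have hle1 : ∀ x : ℚ, |ξ - x| ≤ (x.den : ℝ) ^ (-θ) → |ξ - x| ≤ 1 := fun x hx =>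
    hx.trans (Real.rpow_le_one_of_one_le_of_nonpos (hden x) (by linarith))
  obtain ⟨N, hN⟩ := exists_nat_ge ((n + θ * m * n + 2) / (ε * m))
  rw [div_le_iff₀ (by positivity)] at hN
  have hN0 : 0 < N := by
    rcases Nat.eq_zero_or_pos N with rfl | h
    · have : 0 < (n : ℝ) + θ * m * n + 2 := by positivity
      rw [Nat.cast_zero, zero_mul] at hN
      linarith
    · exact h
  obtain ⟨M, hM1, hM⟩ := exists_thue_siegel_constant hn hm hmn hN0 ha hb hξ hdeg
  obtain ⟨s₀, hs₀⟩ := exists_nat_ge ((N : ℝ) * m * (m - 1) + θ * (n * m + m) + 1)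
  obtain ⟨x, hx, hxM⟩ := exists_den_gt_of_infinite hS hle1 (2 * M)
  obtain ⟨y, hy, hyx⟩ := exists_den_gt_of_infinite hS hle1 ((x.den : ℝ) ^ (N * m * (s₀ + 1)))
  rw [Set.mem_ofPred_eq] at hx hy
  have hq2 : (2 : ℝ) < x.den := by linarith
  have hq0 : (0 : ℝ) < x.den := by linarith
  have hq1 : (1 : ℝ) < x.den := by linarith
  have hqN : 1 < x.den ^ (N * m) := Nat.one_lt_pow (by positivity) (by exact_mod_cast hq1)
  -- This s gives x.den^(Nms) ≤ y.den ≤ x.den^(Nm(s+1)), making the bounds on |ξ - x|^T and |ξ - y|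
  -- comparable.
  set s := Nat.log (x.den ^ (N * m)) y.den with hs
  have hsle : s₀ + 1 ≤ s := by
    refine Nat.le_log_of_pow_le hqN ?_
    rw [← pow_mul]
    exact_mod_cast hyx.le
  have hlow : (x.den : ℝ) ^ (N * m * s) ≤ y.den := by
    have := Nat.pow_log_le_self (x.den ^ (N * m)) (x := y.den) y.pos.ne'
    rw [← hs, ← pow_mul] at this
    exact_mod_cast this
  have hupp : (y.den : ℝ) ≤ (x.den : ℝ) ^ (N * m * (s + 1)) := by
    have := Nat.lt_pow_succ_log_self hqN y.den
    rw [← hs, ← pow_mul] at this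
    exact_mod_cast this.le
  have hMs : M ^ s < y.den := by
    refine lt_of_lt_of_le (pow_lt_pow_left₀ (by linarith : M < x.den) (by linarith) (by omega))
      ((pow_le_pow_right₀ hq1.le ?_).trans hlow)
    exact Nat.le_mul_of_pos_left s (by positivity)
  have key := hM s (by omega) x y (hle1 x hx) (hle1 y hy) hMs
  set K := m * n * s + n * m + m with hK
  set e : ℝ := -θ * ((N : ℝ) * m * s - (m * n * s + n * m + m)) with he
  have h1 : |ξ - x| ^ (N * m * s - K) ≤ (x.den : ℝ) ^ e := by
    refine (pow_le_pow_left₀ (abs_nonneg _) hx _).trans ?_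
    rw [← Real.rpow_natCast, ← Real.rpow_mul hq0.le]
    refine Real.rpow_le_rpow_of_exponent_le hq1.le ?_
    rw [he]
    refine mul_le_mul_of_nonpos_left ?_ (by linarith)
    have : (N * m * s : ℕ) ≤ (N * m * s - K) + K := by omega
    have h' : ((N * m * s : ℕ) : ℝ) ≤ ((N * m * s - K : ℕ) : ℝ) + (K : ℕ) := by exact_mod_cast this
    rw [hK] at h' ⊢
    push_cast at h' ⊢
    linarith
  have h2 : |ξ - y| ≤ (x.den : ℝ) ^ e := by
    refine hy.trans ((Real.rpow_le_rpow_of_nonpos (by positivity) hlow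
      (by linarith)).trans ?_)
    rw [← Real.rpow_natCast, ← Real.rpow_mul hq0.le]
    refine Real.rpow_le_rpow_of_exponent_le hq1.le ?_
    rw [he, mul_comm]
    refine mul_le_mul_of_nonpos_left ?_ (by linarith)
    push_cast
    have : (0 : ℝ) ≤ m * n * s + n * m + m := by positivity
    linarith
  have h3 : (y.den : ℝ) ^ (m - 1) ≤ (x.den : ℝ) ^ (N * m * (s + 1) * (m - 1)) := by
    rw [pow_mul]
    exact pow_le_pow_left₀ (by positivity) hupp _
  have hsR : (s₀ : ℝ) + 1 ≤ s := by exact_mod_cast hsle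
  have hexp := thue_siegel_exponent_le (n := n) (N := N) (s := s) hmR hθ (Nat.cast_nonneg s)
    (by linarith) (by linarith)
  have h4 : (1 : ℝ) ≤ 2 * M ^ s * (x.den : ℝ) ^ (-(s : ℝ)) := by
    calc (1 : ℝ) ≤ _ := key
      _ ≤ M ^ s * (x.den : ℝ) ^ ((N + 1) * n * s) *
          (x.den : ℝ) ^ (N * m * (s + 1) * (m - 1)) * ((x.den : ℝ) ^ e + (x.den : ℝ) ^ e) := by
        gcongr
      _ = 2 * M ^ s * (x.den : ℝ) ^ ((N + 1) * n * s + N * m * (s + 1) * (m - 1) + e) := by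
        have h4 : ((N * m * (s + 1) * (m - 1) : ℕ) : ℝ) = N * m * (s + 1) * (m - 1) := by
          push_cast [Nat.cast_sub hm]
          ring
        rw [Real.rpow_add hq0, Real.rpow_add hq0, ← h4, Real.rpow_natCast]
        have h5 : ((N + 1) * n * s : ℝ) = (((N + 1) * n * s : ℕ) : ℝ) := by push_cast; ring
        rw [h5, Real.rpow_natCast]
        ring
      _ ≤ _ := by
        gcongr
        exact hq1.le
  rw [Real.rpow_neg hq0.le, Real.rpow_natCast, ← div_eq_mul_inv, le_div_iff₀ (by positivity),
    one_mul] at h4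
  have h5 : (2 * M) ^ s < (x.den : ℝ) ^ s :=
    pow_lt_pow_left₀ hxM (by linarith) (by omega)
  rw [mul_pow] at h5
  have h6 : 2 * M ^ s ≤ 2 ^ s * M ^ s := by
    gcongr
    exact le_self_pow₀ one_le_two (by omega)
  linarith

/-- Reducing a fraction only weakens the inequality, so finitely many values p/q occur. Each value x
comes from finitely many pairs, because θ ≥ 1 gives 0 < |ξ - x| ≤ 1/q. -/
theorem finite_approximations {n m a b : ℕ} (hn : 2 ≤ n) (hm : 0 < m) (hmn : m ≤ n)
    (ha : 0 < a) (hb : 0 < b) {ξ : ℝ} (hξ : ξ ^ n = a / b)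
    (hdeg : (minpoly ℚ ξ).natDegree = n) {ε : ℝ} (hε : 0 < ε) :
    {pq : ℤ × ℤ | 0 < pq.2 ∧ |ξ - (pq.1 : ℝ) / (pq.2 : ℝ)| ≤
      (pq.2 : ℝ) ^ (-((n : ℝ) / (m : ℝ) + (m : ℝ) - 1) - ε)}.Finite := by
  have hmR : (1 : ℝ) ≤ m := by exact_mod_cast hm
  set θ : ℝ := n / m + m - 1 + ε with hθ
  have hθ1 : 1 ≤ θ := by
    have : (1 : ℝ) ≤ n / m := by
      rw [one_le_div (by positivity)]
      exact_mod_cast hmn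
    linarith
  have hexp : -((n : ℝ) / (m : ℝ) + (m : ℝ) - 1) - ε = -θ := by rw [hθ]; ring
  rw [hexp]
  have hirr : ∀ x : ℚ, 0 < |ξ - x| := by
    intro x
    refine abs_pos.2 fun h => ?_
    have h1 : ξ = algebraMap ℚ ℝ x := by simpa using sub_eq_zero.1 h
    rw [h1, minpoly.eq_X_sub_C, natDegree_X_sub_C] at hdeg
    omega
  have hfin := finite_rat_approximations hn hm hmn ha hb hξ hdeg hε (by linarith) hθ
  refine (hfin.biUnion fun x _ => finite_setOf_le_of_abs_sub_le ξ (1 / |ξ - x|)).subset ?_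
  rintro ⟨p, q⟩ ⟨hq, hpq⟩
  simp only at hq hpq
  have hq' : (1 : ℝ) ≤ q := by exact_mod_cast hq
  have hq0 : (0 : ℝ) < q := by linarith
  set x : ℚ := (p : ℚ) / q with hx
  have hxR : (x : ℝ) = (p : ℝ) / q := by rw [hx]; push_cast; rfl
  have hdenq : (x.den : ℝ) ≤ q := by
    have h1 : (x.den : ℤ) ∣ q := by
      rw [hx, ← Rat.divInt_eq_div]
      exact Rat.den_dvd p q
    exact_mod_cast Int.le_of_dvd hq h1
  rw [← hxR] at hpq
  have hle : |ξ - x| ≤ 1 / q := by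
    refine hpq.trans ?_
    rw [one_div, ← Real.rpow_neg_one]
    exact Real.rpow_le_rpow_of_exponent_le hq' (by linarith)
  refine Set.mem_biUnion (x := x) ?_ ⟨hq, ?_, ?_⟩
  · exact hpq.trans (Real.rpow_le_rpow_of_nonpos (by exact_mod_cast x.pos) hdenq
      (by linarith))
  · rw [le_one_div hq0 (hirr x)]
    exact hle
  · rw [← hxR]
    exact hle.trans (by rw [div_le_one hq0]; exact hq')

theorem mainTheorem1 (n : ℕ) (hn : 3 ≤ n) (a b : ℕ) (ha : 0 < a) (hb : 0 < b)
    (ξ : ℝ) (hξ : ξ = ((a : ℝ) / (b : ℝ)) ^ (1 / (n : ℝ)))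
    (hdeg : (minpoly ℚ ξ).natDegree = n)
    (ε : ℝ) (hε : 0 < ε) (m : ℕ) (hm : 1 ≤ m) :
    {pq : ℤ × ℤ | 0 < pq.2 ∧
      |ξ - (pq.1 : ℝ) / (pq.2 : ℝ)| ≤
        (pq.2 : ℝ) ^ (-((n : ℝ) / (m : ℝ) + (m : ℝ) - 1) - ε)}.Finite := by
  have hξn : ξ ^ n = a / b := by
    rw [hξ, one_div]
    exact Real.rpow_inv_natCast_pow (by positivity) (by omega)
  rcases le_total m n with hmn | hmn
  · exact finite_approximations (by omega) hm hmn ha hb hξn hdeg hε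
  · refine (finite_approximations (m := n) (by omega) (by omega) le_rfl ha hb hξn hdeg hε).subset ?_
    rintro ⟨p, q⟩ ⟨hq, hpq⟩
    refine ⟨hq, hpq.trans ?_⟩
    have hq' : (1 : ℝ) ≤ q := by exact_mod_cast hq
    refine Real.rpow_le_rpow_of_exponent_le hq' ?_
    have hm' : (1 : ℝ) ≤ m := by exact_mod_cast hm
    have hnm : (n : ℝ) ≤ m := by exact_mod_cast hmn
    have hn0 : (0 : ℝ) < n := by positivity
    -- Equivalent to (m - n)(m - 1) ≥ 0: for m ≥ n the exponent is at least as strong as the one for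
    -- m = n.
    have h1 : (n : ℝ) + 1 ≤ n / m + m := by
      rw [div_add' _ _ _ (by positivity), le_div_iff₀ (by positivity)]
      nlinarith
    rw [div_self hn0.ne']
    linarith
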